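/- There exist absolute constants $K>0$ and $C>0$ such that the following holds for all real numbers $\nu,\alpha,\lambda,\beta$ with $0<\nu\le 1$, $|\alpha|\ge K\nu^2$ and $|\beta|>1$. Let $\mathbb T=\mathbb R/2\pi\mathbb Z$; all functions are complex-valued, and derivatives are weak derivatives on $\mathbb T$. (1) Let $\tilde\beta\in\mathbb R$ with $\tilde\beta^2=\beta^2-1$, let $u\in H^2(\mathbb T)$, and let $\varphi\in H^2(\mathbb T)$ satisfy $(\partial_y^2-\tilde\beta^2)\varphi=u$. Then $$\Big\|\, i\frac{\alpha}{\nu}\big[(\sin y-\lambda)u+\lambda\varphi\big]-\nu\,\partial_y^2u\,\Big\|_{L^2(\mathbb T)}\ \ge\ C|\alpha|^{1/2}\,\|u\|_{L^2(\mathbb T)} .$$ (2) Let $w\in H^2(\mathbb T)$, let $\varphi\in H^2(\mathbb T)$ satisfy $(\partial_y^2-\beta^2)\varphi=w$, and put $L_\lambda w=i\frac{\alpha}{\nu}\big[(\sin y-\lambda)w+\sin y\,\varphi\big]-\nu\,\partial_y^2w$. Then $$\|L_\lambda w\|_{L^2(\mathbb T)}\ \ge\ C|\alpha|^{1/2}\,(1-\beta^{-2})\,\|w\|_{L^2(\mathbb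 T)} .$$ The constants $K$ and $C$ do not depend on $\nu,\alpha,\lambda,\beta$ or on the functions. -/

import Mathlib

open MeasureTheory
open scoped ContDiff

/-- `f` represents an element of `L²(𝕋)`, `𝕋 = ℝ/2πℤ`: it is `2π`-periodic and square integrable
over one period. -/
structure MemL2T (f : ℝ → ℂ) : Prop where
  periodic : Function.Periodic f (2 * Real.pi)
  memLp : MemLp f 2 (volume.restrict (Set.Ioc 0 (2 * Real.pi)))

/-- The norm of `L²(𝕋)`: the square root of the integral of `|f|²` over one period. -/
noncomputable def l2NormT (f : ℝ → ℂ) : ℝ :=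
  Real.sqrt (∫ y in (0 : ℝ)..(2 * Real.pi), ‖f y‖ ^ 2)

/-- `g` is a weak derivative of `f` on `𝕋`; the test functions are the smooth `2π`-periodic
complex-valued functions. -/
def HasWeakDerivT (f g : ℝ → ℂ) : Prop :=
  ∀ ψ : ℝ → ℂ, ContDiff ℝ ∞ ψ → Function.Periodic ψ (2 * Real.pi) →
    ∫ y in (0 : ℝ)..(2 * Real.pi), f y * deriv ψ y
      = -∫ y in (0 : ℝ)..(2 * Real.pi), g y * ψ y

/-- `f` belongs to `H²(𝕋)` and `f₂` is its second weak derivative: `f`, its weak derivative `f₁`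
and the weak derivative `f₂` of `f₁` all lie in `L²(𝕋)`. (The function `f₂` is determined by `f`
up to a null set.) -/
def MemH2TWith (f f₂ : ℝ → ℂ) : Prop :=
  MemL2T f ∧ MemL2T f₂ ∧ ∃ f₁ : ℝ → ℂ, MemL2T f₁ ∧ HasWeakDerivT f f₁ ∧ HasWeakDerivT f₁ f₂

/-- `φ ∈ H²(𝕋)` solves `(∂_y² - b) φ = f` almost everywhere. -/
def SolvesHelmholtzT (b : ℝ) (φ f : ℝ → ℂ) : Prop :=
  ∃ φ₂ : ℝ → ℂ, MemH2TWith φ φ₂ ∧ ∀ᵐ y : ℝ, φ₂ y - (b : ℂ) * φ y = f y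

/-- The function `i (α/ν) [(sin y - lam) w + (sin y) φ] - ν w''`, where `w₂` stands for `w''`. -/
noncomputable def fullOperator (ν α lam : ℝ) (w w₂ φ : ℝ → ℂ) : ℝ → ℂ := fun y =>
  Complex.I * ((α / ν : ℝ) : ℂ) *
      (((Real.sin y - lam : ℝ) : ℂ) * w y + ((Real.sin y : ℝ) : ℂ) * φ y)
    - (ν : ℂ) * w₂ y

/-- The function `i (α/ν) [(sin y - lam) u + lam φ] - ν u''`, where `u₂` stands for `u''`. -/
noncomputable def reducedOperator (ν α lam : ℝ) (u u₂ φ : ℝ → ℂ) : ℝ → ℂ := fun y =>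
  Complex.I * ((α / ν : ℝ) : ℂ) *
      (((Real.sin y - lam : ℝ) : ℂ) * u y + (lam : ℂ) * φ y)
    - (ν : ℂ) * u₂ y

/-! Dividing by `ν` leaves the single parameter `A = α / ν ^ 2` and the operator `i A G - ∂²`, where
`G u = (sin - l) u + l φ` is bounded and self-adjoint. Near the maximum of sine, `1 - sin` vanishes
quadratically; balancing `|A| δ²` against `δ⁻²` gives the length `δ = |A|^(-1/4) = 1 / a` and the
rate `a ^ 2 = |A|^(1/2)`.

For `l ≥ 0`, pairing `G u` with `-(cos u)' - u / 2` gives a sum of nonnegative forms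
(`commutator_identity`), which controls `1 - sin` and the nonlocal part of `G`. The weight `1 + a ^
2 (1 - sin + l (r - ∂²)⁻¹)` is affine in `G`, so the term `i A G u` drops out of the weighted energy
identity. Together with the uncertainty inequality at the zero of `1 - sin`, this yields the rate `a
^ 2` in the energy norm (`energy_le_energy`). Negative `l` is reduced to positive `l` by translating
the circle by half a period.

The energy norm is equivalent to the `L²` norm only with constants that depend on `a`. The adjoint
of the resolvent is the resolvent for `-A` and obeys the same energy bound, so Krein's
symmetrization carries the bound to `L²` without loss
(`ContinuousLinearMap.norm_apply_le_of_equivalent_bounds`).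

The full operator reduces to the other through `u = w + φ`: the two differ by `φ''`, which is at
most `‖u‖` in norm and is absorbed once `|A|` is large (`norm_full_ge`). -/

/-- The real part of the complex inner product. -/
noncomputable def reInner {H : Type*} [NormedAddCommGroup H] [InnerProductSpace ℂ H]
    (x y : H) : ℝ :=
  (inner ℂ x y).re

namespace reInner

variable {H : Type*} [NormedAddCommGroup H] [InnerProductSpace ℂ H]

theorem symm (x y : H) : reInner x y = reInner y x := by
  unfold reInner
  rw [← inner_conj_symm, Complex.conj_re]

theorem add_left (x y z : H) : reInner (x + y) z = reInner x z + reInner y z := by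
  simp [reInner]

theorem sub_left (x y z : H) : reInner (x - y) z = reInner x z - reInner y z := by
  simp [reInner]

theorem neg_left (x z : H) : reInner (-x) z = -reInner x z := by
  simp [reInner]

theorem add_right (x y z : H) : reInner x (y + z) = reInner x y + reInner x z := by
  simp [reInner]

theorem sub_right (x y z : H) : reInner x (y - z) = reInner x y - reInner x z := by
  simp [reInner]

theorem neg_right (x z : H) : reInner x (-z) = -reInner x z := by
  simp [reInner]

theorem smul_left (a : ℝ) (x z : H) : reInner ((a : ℂ) • x) z = a * reInner x z := by
  simp [reInner]

theorem smul_right (a : ℝ) (x z : H) : reInner x ((a : ℂ) • z) = a * reInner x z := by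
  simp [reInner]

theorem I_left (x z : H) : reInner (Complex.I • x) z = -reInner x (Complex.I • z) := by
  simp [reInner]

theorem I_self (x : H) : reInner x (Complex.I • x) = 0 := by
  have h1 := I_left x x
  have h2 := symm (Complex.I • x) x
  linarith

theorem self (x : H) : reInner x x = ‖x‖ ^ 2 := by
  unfold reInner
  rw [inner_self_eq_norm_sq_to_K]
  norm_cast

theorem abs_le (x y : H) : |reInner x y| ≤ ‖x‖ * ‖y‖ :=
  (Complex.abs_re_le_norm _).trans (norm_inner_le_norm x y)

theorem le (x y : H) : reInner x y ≤ ‖x‖ * ‖y‖ := (le_abs_self _).trans (abs_le x y)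

theorem neg_le (x y : H) : -reInner x y ≤ ‖x‖ * ‖y‖ := (neg_le_abs _).trans (abs_le x y)

end reInner

/-! ### Abstract trigonometric calculus and the positive commutator. -/

/-- Operators on a Hilbert space that obey the rules of the calculus of `L²(𝕋)`: `s` and `c` stand
for multiplication by sine and cosine, `D u v` says that `v` is the derivative of `u`, and `Q r` is
`(r - ∂²)^{-1/2}`. -/
structure TrigCalculus (H : Type*) [NormedAddCommGroup H] [InnerProductSpace ℂ H] where
  s : H →L[ℂ] H
  c : H →L[ℂ] H
  D : H → H → Prop
  Q : ℝ → H →L[ℂ] H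
  s_symm : ∀ x y, inner ℂ (s x) y = inner ℂ x (s y)
  c_symm : ∀ x y, inner ℂ (c x) y = inner ℂ x (c y)
  s_c : ∀ x, s (c x) = c (s x)
  c_c : ∀ x, c (c x) = x - s (s x)
  D_skew : ∀ {x x' y y'}, D x x' → D y y' → inner ℂ x' y = -inner ℂ x y'
  D_s : ∀ {x x'}, D x x' → D (s x) (s x' + c x)
  D_c : ∀ {x x'}, D x x' → D (c x) (c x' - s x)
  D_add : ∀ {x x' y y'}, D x x' → D y y' → D (x + y) (x' + y')
  D_smul : ∀ (a : ℂ) {x x'}, D x x' → D (a • x) (a • x')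
  Q_symm : ∀ {r}, 0 < r → ∀ x y, inner ℂ (Q r x) y = inner ℂ x (Q r y)
  D_Q : ∀ {r}, 0 < r → ∀ {x x'}, D x x' → D (Q r (Q r x)) (Q r (Q r x'))
  resolvent : ∀ {r}, 0 < r → ∀ x, ∃ p, D (Q r (Q r x)) p ∧ D p ((r : ℂ) • Q r (Q r x) - x)
  resolvent_left : ∀ {r}, 0 < r → ∀ {x x' x''}, D x x' → D x' x'' →
    Q r (Q r ((r : ℂ) • x - x'')) = x

namespace TrigCalculus

variable {H : Type*} [NormedAddCommGroup H] [InnerProductSpace ℂ H] (T : TrigCalculus H)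

theorem re_s (x y : H) : reInner x (T.s y) = reInner (T.s x) y := by
  simp [reInner, T.s_symm]

theorem re_c (x y : H) : reInner x (T.c y) = reInner (T.c x) y := by
  simp [reInner, T.c_symm]

theorem re_c_symm (x y : H) : reInner (T.c x) y = reInner (T.c y) x := by
  rw [← T.re_c, reInner.symm]

variable {T}

theorem re_D {x x' y y' : H} (hx : T.D x x') (hy : T.D y y') : reInner x' y = -reInner x y' := by
  simp [reInner, T.D_skew hx hy]

theorem D_sub {x x' y y' : H} (hx : T.D x x') (hy : T.D y y') : T.D (x - y) (x' - y') := by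
  simpa [sub_eq_add_neg] using T.D_add hx (T.D_smul (-1) hy)

variable (T)

/-- The shift of the circle by half a period. -/
def halfShift : TrigCalculus H where
  s := -T.s
  c := -T.c
  D := T.D
  Q := T.Q
  s_symm x y := by simp [T.s_symm]
  c_symm x y := by simp [T.c_symm]
  s_c x := by simp [T.s_c]
  c_c x := by simp [T.c_c]
  D_skew := T.D_skew
  D_s h := by simpa [add_comm] using T.D_smul (-1) (T.D_s h)
  D_c h := by simpa [add_comm, sub_eq_add_neg] using T.D_smul (-1) (T.D_c h)
  D_add := T.D_add
  D_smul := T.D_smul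
  Q_symm := T.Q_symm
  D_Q := T.D_Q
  resolvent := T.resolvent
  resolvent_left := T.resolvent_left

/-- The quadratic form of multiplication by `1 - sin`. -/
noncomputable def formP (x : H) : ℝ := reInner (x - T.s x) x

/-- The quadratic form of multiplication by `1 + sin`. -/
noncomputable def formQ (x : H) : ℝ := reInner (x + T.s x) x

/-- Since `c² = (1 - s)(1 + s)`, this is a weighted Young inequality. Square roots of `1 ± s` are
avoided by adding the squares of `(1 + s) x - c y` and `c x - (1 - s) y`, whose sum is twice the
difference of the two sides. -/
theorem re_c_le (x y : H) : 2 * reInner (T.c x) y ≤ T.formQ x + T.formP y := by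
  have h1 : 0 ≤ reInner (x + T.s x - T.c y) (x + T.s x - T.c y) := by
    rw [reInner.self]; positivity
  have h2 : 0 ≤ reInner (T.c x - (y - T.s y)) (T.c x - (y - T.s y)) := by
    rw [reInner.self]; positivity
  have e3 := T.re_c_symm x y
  have e8 : reInner (T.c (T.s x)) y = reInner (T.c (T.s y)) x := by
    rw [T.re_c_symm, ← T.s_c y, T.re_s]
  unfold formP formQ
  simp only [reInner.add_left, reInner.sub_left, reInner.add_right, reInner.sub_right, T.re_s,
    T.re_c, T.s_c, T.c_c, map_add, map_sub] at h1 h2 ⊢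
  linarith

theorem neg_re_c_le (x y : H) : -(2 * reInner (T.c x) y) ≤ T.formQ x + T.formP y := by
  have h := T.re_c_le x (-y)
  have h' : T.formP (-y) = T.formP y := by
    simp only [formP, map_neg, sub_neg_eq_add, reInner.add_left, reInner.sub_left,
      reInner.neg_left, reInner.neg_right]
    ring
  rw [reInner.neg_right, h'] at h
  linarith

/-- The gap is a square: `2 (1 - s) - c² = (1 - s)²`. Nonnegativity of `formP` follows from this. -/
theorem norm_c_sq_le_formP (x : H) : ‖T.c x‖ ^ 2 ≤ 2 * T.formP x := by
  have h1 : 0 ≤ reInner (x - T.s x) (x - T.s x) := by rw [reInner.self]; positivity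
  have e4 := reInner.symm x (T.s x)
  rw [← reInner.self]
  unfold formP
  simp only [reInner.sub_left, reInner.sub_right, T.re_s, T.re_c, T.c_c, map_sub] at h1 e4 ⊢
  linarith

theorem norm_c_sq_le_formQ (x : H) : ‖T.c x‖ ^ 2 ≤ 2 * T.formQ x := by
  have h1 : 0 ≤ reInner (x + T.s x) (x + T.s x) := by rw [reInner.self]; positivity
  have e4 := reInner.symm x (T.s x)
  rw [← reInner.self]
  unfold formQ
  simp only [reInner.sub_left, reInner.add_left, reInner.add_right, T.re_s, T.re_c,
    T.c_c, map_add] at h1 e4 ⊢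
  linarith

theorem formP_nonneg (x : H) : 0 ≤ T.formP x := by
  nlinarith [T.norm_c_sq_le_formP x, sq_nonneg ‖T.c x‖]

theorem formQ_nonneg (x : H) : 0 ≤ T.formQ x := by
  nlinarith [T.norm_c_sq_le_formQ x, sq_nonneg ‖T.c x‖]

variable {T}

/-- The positive commutator identity for the inviscid operator `u ↦ (sin - l) u + l φ`. -/
theorem commutator_identity (l r : ℝ) {u u₁ φ φ₁ φ₂ : H} (hu : T.D u u₁) (hφ : T.D φ φ₁)
    (hφ₁ : T.D φ₁ φ₂) (hφu : φ₂ = u + (r : ℂ) • φ) :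
    reInner (T.s u - (l : ℂ) • u + (l : ℂ) • φ) (T.s u - T.c u₁ - ((1 / 2 : ℝ) : ℂ) • u)
      = (1 + l) / 2 * T.formP u + l / 2 * T.formQ φ₁ + l * r / 2 * T.formP φ := by
  -- The multiplier is the skew operator `-(c ∂ + ∂ c) / 2` applied to `u`, minus `(1 - s) u / 2`.
  -- For the local part the commutator gives `c² / 2 = (1 - s)(1 + s) / 2`, and the correction turns
  -- this into `(1 + l)(1 - s) / 2`.
  have h1 := re_D (T.D_c (T.D_s hu)) hu
  have h2 := re_D (T.D_c hu) hu
  have h3 := re_D (T.D_c hφ) hu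
  have h4 := re_D (T.D_c hφ₁) hφ₁
  have h5 := re_D (T.D_c hφ) hφ
  have h6 := re_D hφ hφ₁
  have e1 : reInner (T.c (T.s u₁)) u = reInner (T.c (T.s u)) u₁ := by
    rw [T.re_c_symm, ← T.s_c, T.re_s]
  have e2 := T.re_c_symm u u₁
  have e3 := T.re_c_symm φ φ₁
  have e4 := T.re_c_symm φ₁ φ₂
  have hu' : u = φ₂ - (r : ℂ) • φ := by rw [hφu]; abel
  have k1 : reInner (T.c φ₁) u = reInner (T.c φ₁) φ₂ - r * reInner (T.c φ₁) φ := by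
    rw [hu', reInner.sub_right, reInner.smul_right]
  have k2 : reInner φ u = reInner φ φ₂ - r * reInner φ φ := by
    rw [hu', reInner.sub_right, reInner.smul_right]
  unfold formP formQ
  simp only [reInner.add_left, reInner.sub_left, reInner.sub_right, T.re_s, T.re_c, T.c_c,
    map_add, map_sub, map_smul, reInner.smul_left, reInner.smul_right] at *
  linear_combination (-1 / 2) * h1 + (1 / 2) * e1 + (l / 2) * h2 + (l / 2) * e2 - l * h3 + l * k1
    + (l / 2) * h4 + (l / 2) * e4 - (l * r / 2) * h5 + (l * r / 2) * e3 - (l / 2) * k2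
    - (l / 2) * h6
end TrigCalculus

/-! ### Weighted energy estimate. -/

/-- The chain of scalar inequalities that closes the hypocoercive estimate. -/
theorem eq_zero_of_hypocoercive_bounds {a e n U₁ U₂ C₀ C₁ F Cf P M X : ℝ} (ha : 1 ≤ a)
    (he : 0 ≤ e) (hn0 : 0 ≤ n) (hU₁ : 0 ≤ U₁) (hC₁ : 0 ≤ C₁)
    (hF0 : 0 ≤ F) (hF : F ≤ a ^ 2 / 20736 * e) (hn : n ≤ e) (hC₀e : a * C₀ ≤ 3 / 2 * e)
    (hCf : a * Cf ≤ 3 / 2 * (a ^ 2 / 20736 * e)) (h1 : U₁ ^ 2 ≤ F * n)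
    (h2 : a ^ 2 * C₁ ^ 2 ≤ 2 * (a ^ 2 / 20736 * e ^ 2 + a ^ 2 * (U₁ * C₀)))
    (h3 : U₂ ^ 2 ≤ F * U₂ + a ^ 4 * (C₀ * U₁))
    (h4 : a ^ 4 * M ≤ 3 / 2 * (F * n) + Cf * U₁ + U₂ * C₁ + 2 * (C₀ * U₁))
    (h5 : X ≤ 6 * M) (h6 : P ≤ 2 * M) (h7 : n ^ 2 ≤ P + 2 * (C₀ * U₁))
    (h8 : e ^ 2 = n ^ 2 + a ^ 2 * X) : e = 0 := by
  have ha0 : 0 < a := by linarith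
  -- The constant is `20736 = 144 ^ 2`, so that the bound on `U₁ ^ 2` has a rational square root.
  have hFn : F * n ≤ a ^ 2 / 20736 * e ^ 2 := by
    calc F * n ≤ (a ^ 2 / 20736 * e) * e := mul_le_mul hF hn hn0 (by positivity)
      _ = _ := by ring
  have bU₁ : U₁ ≤ a / 144 * e := by
    refine le_of_sq_le_sq ?_ (by positivity)
    calc U₁ ^ 2 ≤ a ^ 2 / 20736 * e ^ 2 := h1.trans hFn
      _ = _ := by ring
  have bCU : C₀ * U₁ ≤ e ^ 2 / 96 := by
    have : a * (C₀ * U₁) ≤ a * (e ^ 2 / 96) := by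
      calc a * (C₀ * U₁) = (a * C₀) * U₁ := by ring
        _ ≤ (3 / 2 * e) * (a / 144 * e) := mul_le_mul hC₀e bU₁ hU₁ (by positivity)
        _ = _ := by ring
    exact le_of_mul_le_mul_left this ha0
  have bC₁ : C₁ ≤ 5 / 24 * e := by
    refine le_of_sq_le_sq ?_ (by positivity)
    have : a ^ 2 * C₁ ^ 2 ≤ a ^ 2 * (5 / 24 * e) ^ 2 := by
      have : a ^ 2 * (U₁ * C₀) ≤ a ^ 2 * (e ^ 2 / 96) := by
        rw [mul_comm U₁]; gcongr
      linarith [mul_nonneg (sq_nonneg a) (sq_nonneg e)]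
    exact le_of_mul_le_mul_left this (by positivity)
  have bU₂ : U₂ ≤ a ^ 2 / 6 * e := by
    refine le_of_sq_le_sq ?_ (by positivity)
    have i1 : F ^ 2 ≤ (a ^ 2 / 20736 * e) ^ 2 := by gcongr
    have i2 : a ^ 4 * (C₀ * U₁) ≤ a ^ 4 * (e ^ 2 / 96) := by gcongr
    have i3 : 0 ≤ a ^ 4 * e ^ 2 := by positivity
    nlinarith [sq_nonneg (F - U₂)]
  have bCfU : Cf * U₁ ≤ a ^ 2 * e ^ 2 * (1 / 1990656) := by
    have : a * (Cf * U₁) ≤ a * (a ^ 2 * e ^ 2 * (1 / 1990656)) := by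
      calc a * (Cf * U₁) = (a * Cf) * U₁ := by ring
        _ ≤ (3 / 2 * (a ^ 2 / 20736 * e)) * (a / 144 * e) := mul_le_mul hCf bU₁ hU₁ (by positivity)
        _ = _ := by ring
    exact le_of_mul_le_mul_left this ha0
  have bUC : U₂ * C₁ ≤ a ^ 2 * e ^ 2 * (5 / 144) := by
    calc U₂ * C₁ ≤ (a ^ 2 / 6 * e) * (5 / 24 * e) := mul_le_mul bU₂ bC₁ hC₁ (by positivity)
      _ = _ := by ring
  -- The term `2 * (C₀ * U₁)` in `h4` carries no power of `a`; `1 ≤ a` lets it join the others.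
  have hae : e ^ 2 ≤ a ^ 2 * e ^ 2 := by nlinarith [sq_nonneg e, mul_self_nonneg (a - 1)]
  have bM : a ^ 2 * M ≤ 11 / 144 * e ^ 2 := by
    have : a ^ 2 * (a ^ 2 * M) ≤ a ^ 2 * (11 / 144 * e ^ 2) := by
      linarith [mul_nonneg (sq_nonneg a) (sq_nonneg e)]
    exact le_of_mul_le_mul_left this (by positivity)
  have bX : a ^ 2 * X ≤ 6 * (a ^ 2 * M) := by
    linarith [mul_le_mul_of_nonneg_left h5 (sq_nonneg a)]
  have bP : P ≤ 2 * (11 / 144 * e ^ 2) := by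
    rcases le_or_gt M 0 with hM | hM
    · linarith [sq_nonneg e]
    · have : M ≤ a ^ 2 * M := le_mul_of_one_le_left hM.le (one_le_pow₀ ha)
      linarith
  -- By `h7` and `h8`, `e ^ 2` is at most `22/144 + 3/144 + 66/144 = 91/144` times itself; the
  -- shares come from `P`, `2 * (C₀ * U₁)` and `a ^ 2 * X`.
  exact pow_eq_zero_iff two_ne_zero |>.1 (le_antisymm (by linarith [sq_nonneg e]) (sq_nonneg e))

/-- The form of a symmetric operator is real. Hence the large term `i A G u` disappears from the
real part of the energy identities. -/
theorem reInner.I_smul_symm {H : Type*} [NormedAddCommGroup H] [InnerProductSpace ℂ H]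
    {G : H →L[ℂ] H} (hG : ∀ x y, inner ℂ (G x) y = inner ℂ x (G y)) (x : H) :
    reInner (Complex.I • G x) x = 0 := by
  have h1 := reInner.I_left (G x) x
  have h2 : reInner (G x) (Complex.I • x) = reInner x (Complex.I • G x) := by
    rw [reInner, reInner, hG, map_smul]
  have h3 := reInner.symm x (Complex.I • G x)
  linarith

namespace TrigCalculus

variable {H : Type*} [NormedAddCommGroup H] [InnerProductSpace ℂ H] (T : TrigCalculus H)

/-- The inviscid operator `u ↦ (sin - l) u + l φ`, where `(∂² - r) φ = u`. -/
noncomputable def inviscid (l r : ℝ) : H →L[ℂ] H :=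
  T.s - (l : ℂ) • (1 : H →L[ℂ] H) - (l : ℂ) • (T.Q r).comp (T.Q r)

/-- The weight `1 + a² (1 - sin + l (r - ∂²)⁻¹)`; it is a function of the inviscid operator. -/
noncomputable def weight (a l r : ℝ) : H →L[ℂ] H :=
  ((1 + a ^ 2 * (1 - l) : ℝ) : ℂ) • (1 : H →L[ℂ] H) - ((a ^ 2 : ℝ) : ℂ) • T.inviscid l r

/-- The quadratic form of the weight. -/
noncomputable def energy (a l r : ℝ) (x : H) : ℝ := reInner (T.weight a l r x) x

theorem inviscid_apply (l r : ℝ) (x : H) :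
    T.inviscid l r x = T.s x - (l : ℂ) • x - (l : ℂ) • T.Q r (T.Q r x) := by
  simp [inviscid]

theorem weight_apply (a l r : ℝ) (x : H) : T.weight a l r x =
    ((1 + a ^ 2 * (1 - l) : ℝ) : ℂ) • x - ((a ^ 2 : ℝ) : ℂ) • T.inviscid l r x := by
  simp [weight]

theorem inviscid_symm (l : ℝ) {r : ℝ} (hr : 0 < r) (x y : H) :
    inner ℂ (T.inviscid l r x) y = inner ℂ x (T.inviscid l r y) := by
  simp only [inviscid_apply, inner_sub_left, inner_sub_right, inner_smul_left, inner_smul_right,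
    T.s_symm, T.Q_symm hr, Complex.conj_ofReal]

theorem weight_symm (a l : ℝ) {r : ℝ} (hr : 0 < r) (x y : H) :
    inner ℂ (T.weight a l r x) y = inner ℂ x (T.weight a l r y) := by
  simp only [weight_apply, inner_sub_left, inner_sub_right, inner_smul_left, inner_smul_right,
    T.inviscid_symm l hr, Complex.conj_ofReal]

theorem energy_eq (a l : ℝ) {r : ℝ} (hr : 0 < r) (x : H) :
    T.energy a l r x = ‖x‖ ^ 2 + a ^ 2 * (T.formP x + l * ‖T.Q r x‖ ^ 2) := by
  have h : reInner (T.Q r (T.Q r x)) x = ‖T.Q r x‖ ^ 2 := by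
    rw [← reInner.self, reInner, reInner, T.Q_symm hr]
  simp only [energy, weight_apply, inviscid_apply, formP, reInner.sub_left, reInner.smul_left, h,
    ← reInner.self x]
  ring

theorem norm_sq_le_energy (a : ℝ) {l r : ℝ} (hr : 0 < r) (hl : 0 ≤ l) (x : H) :
    ‖x‖ ^ 2 ≤ T.energy a l r x := by
  rw [T.energy_eq a l hr]
  have := T.formP_nonneg x
  have : 0 ≤ a ^ 2 * (T.formP x + l * ‖T.Q r x‖ ^ 2) := by positivity
  linarith

theorem energy_nonneg (a : ℝ) {l r : ℝ} (hr : 0 < r) (hl : 0 ≤ l) (x : H) :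
    0 ≤ T.energy a l r x :=
  (sq_nonneg _).trans (T.norm_sq_le_energy a hr hl x)

theorem norm_c_sq_le_energy (a : ℝ) {l r : ℝ} (hr : 0 < r) (hl : 0 ≤ l) (x : H) :
    a ^ 2 * ‖T.c x‖ ^ 2 ≤ 2 * T.energy a l r x := by
  rw [T.energy_eq a l hr]
  have h := mul_le_mul_of_nonneg_left (T.norm_c_sq_le_formP x) (sq_nonneg a)
  have : 0 ≤ a ^ 2 * (l * ‖T.Q r x‖ ^ 2) := by positivity
  nlinarith [sq_nonneg ‖x‖]

theorem norm_s_le (x : H) : ‖T.s x‖ ≤ ‖x‖ := by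
  refine le_of_sq_le_sq ?_ (norm_nonneg _)
  have h : ‖T.c x‖ ^ 2 = ‖x‖ ^ 2 - ‖T.s x‖ ^ 2 := by
    simp only [← reInner.self, T.re_c, T.re_s, T.c_c, reInner.sub_left]
  nlinarith [sq_nonneg ‖T.c x‖]

theorem re_weight_symm (a l : ℝ) {r : ℝ} (hr : 0 < r) (x y : H) :
    reInner (T.weight a l r x) y = reInner (T.weight a l r y) x := by
  rw [reInner.symm (T.weight a l r y), reInner, reInner, T.weight_symm a l hr]

/-- A form of the Cauchy--Schwarz inequality for the weight. -/
theorem re_weight_le (a : ℝ) {l r m E : ℝ} (hr : 0 < r) (hl : 0 ≤ l) (hm : 0 < m) (x y : H)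
    (hx : T.energy a l r x ≤ m ^ 2 * E) (hy : T.energy a l r y ≤ E) :
    reInner x (T.weight a l r y) ≤ m * E := by
  -- Expanding the energy of `x - m y` gives the bound after division by `2 m`, without square roots
  -- of energies.
  have h := T.energy_nonneg a hr hl (x - (m : ℂ) • y)
  have e1 := T.re_weight_symm a l hr x y
  have e2 := reInner.symm x (T.weight a l r y)
  have hm2 := mul_le_mul_of_nonneg_left hy (sq_nonneg m)
  simp only [energy, map_sub, map_smul, reInner.sub_left, reInner.sub_right, reInner.smul_left,
    reInner.smul_right] at h hx hy hm2
  have : m * reInner x (T.weight a l r y) ≤ m * (m * E) := by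
    rw [e1] at h
    rw [e2]
    nlinarith
  exact le_of_mul_le_mul_left this hm

variable {T}

theorem D_inviscid (l : ℝ) {r : ℝ} (hr : 0 < r) {u u₁ : H} (hu : T.D u u₁) :
    T.D (T.inviscid l r u) (T.inviscid l r u₁ + T.c u) := by
  have h := D_sub (D_sub (T.D_s hu) (T.D_smul (l : ℂ) hu)) (T.D_smul (l : ℂ) (T.D_Q hr hu))
  rw [inviscid_apply, inviscid_apply]
  convert h using 1
  abel

theorem D_weight (a l : ℝ) {r : ℝ} (hr : 0 < r) {u u₁ : H} (hu : T.D u u₁) :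
    T.D (T.weight a l r u) (T.weight a l r u₁ - ((a ^ 2 : ℝ) : ℂ) • T.c u) := by
  have h := D_sub (T.D_smul ((1 + a ^ 2 * (1 - l) : ℝ) : ℂ) hu)
    (T.D_smul ((a ^ 2 : ℝ) : ℂ) (D_inviscid l hr hu))
  rw [weight_apply, weight_apply]
  convert h using 1
  rw [smul_add]
  abel

/-- These make the commutator coercive: it dominates exactly the part of the energy that carries the
factor `a ^ 2`. -/
theorem commutator_bounds {l r : ℝ} (hr : 0 < r) (hl : 0 ≤ l) {u u₁ : H} (hu : T.D u u₁) :
    T.formP u ≤ 2 * reInner (T.inviscid l r u) (T.s u - T.c u₁ - ((1 / 2 : ℝ) : ℂ) • u) ∧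
    T.formP u + l * ‖T.Q r u‖ ^ 2
      ≤ 6 * reInner (T.inviscid l r u) (T.s u - T.c u₁ - ((1 / 2 : ℝ) : ℂ) • u) := by
  obtain ⟨p, hp, hp'⟩ := T.resolvent hr u
  have hφ := T.D_smul (-1) hp
  have hφ₁ := T.D_smul (-1) hp'
  set φ : H := (-1 : ℂ) • T.Q r (T.Q r u) with hφdef
  set φ₁ : H := (-1 : ℂ) • p
  set φ₂ : H := (-1 : ℂ) • ((r : ℂ) • T.Q r (T.Q r u) - u) with hφ₂
  have hφu : φ₂ = u + (r : ℂ) • φ := by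
    rw [hφ₂, hφdef, smul_sub, smul_comm]; simp [sub_eq_add_neg, add_comm]
  have key := commutator_identity l r hu hφ hφ₁ hφu
  have hg : T.inviscid l r u = T.s u - (l : ℂ) • u + (l : ℂ) • φ := by
    rw [inviscid_apply, hφdef]; simp [sub_eq_add_neg]
  rw [hg, key]
  have hPu := T.formP_nonneg u
  have hQ := T.formQ_nonneg φ₁
  have hPφ := T.formP_nonneg φ
  have n1 : 0 ≤ l * T.formQ φ₁ := by positivity
  have n2 : 0 ≤ l * r * T.formP φ := by positivity
  have n3 : 0 ≤ l * T.formP u := by positivity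
  -- Integration by parts gives `‖Q u‖² = ‖φ₁‖² + r ‖φ‖²`. The sine terms in the two forms add up to
  -- `⟨s φ₁, φ₁⟩ - r ⟨s φ, φ⟩ = 2 ⟨c φ₁, u⟩`, the real parts being understood.
  have hK : ‖T.Q r u‖ ^ 2 = T.formQ φ₁ + r * T.formP φ - 2 * reInner (T.c φ₁) u := by
    have h0 : ‖T.Q r u‖ ^ 2 = -reInner φ u := by
      rw [← reInner.self, hφdef, neg_one_smul, reInner.neg_left, neg_neg, reInner, reInner,
        T.Q_symm hr (T.Q r u) u]
    have h4 := re_D (T.D_c hφ₁) hφ₁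
    have h5 := re_D (T.D_c hφ) hφ
    have h6 := re_D hφ hφ₁
    have e3 := T.re_c_symm φ φ₁
    have e4 := T.re_c_symm φ₁ φ₂
    have hu' : u = φ₂ - (r : ℂ) • φ := by rw [hφu]; abel
    have k1 : reInner (T.c φ₁) u = reInner (T.c φ₁) φ₂ - r * reInner (T.c φ₁) φ := by
      rw [hu', reInner.sub_right, reInner.smul_right]
    have k2 : reInner φ u = reInner φ φ₂ - r * reInner φ φ := by
      rw [hu', reInner.sub_right, reInner.smul_right]
    rw [h0]
    unfold formP formQ
    simp only [reInner.add_left, reInner.sub_left] at h4 h5 ⊢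
    linear_combination (-1) * k2 + 2 * k1 + h4 + e4 - r * h5 + r * e3 - h6
  have hc := T.neg_re_c_le φ₁ u
  refine ⟨by nlinarith, ?_⟩
  have := mul_le_mul_of_nonneg_left hc hl
  rw [hK]
  nlinarith

/-- The resolvent estimate in the energy norm. -/
theorem energy_le_energy {a l r t A : ℝ} (ha : 1 ≤ a) (hl : 0 ≤ l) (hr : 0 < r) (ht0 : 0 ≤ t)
    (ht1 : t ≤ 1) (hA : |A| = a ^ 4) {u u₁ u₂ f : H} (hu : T.D u u₁) (hu₁ : T.D u₁ u₂)
    (hf : f = Complex.I • (A : ℂ) • T.inviscid l r u - u₂ + (t : ℂ) • u) :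
    (a ^ 2 / 20736) ^ 2 * T.energy a l r u ≤ T.energy a l r f := by
  -- Under the negation every norm of `f` is bounded by a small multiple of `a ^ 2 * e`, so all
  -- quantities can be compared with `e`.
  by_contra! hlt
  have hfe := hlt.le
  have hm0 : 0 < a ^ 2 / 20736 := by positivity
  set m := a ^ 2 / 20736 with hm
  set e := Real.sqrt (T.energy a l r u) with he
  have he2 : e ^ 2 = T.energy a l r u := Real.sq_sqrt (T.energy_nonneg a hr hl u)
  have he0 : 0 ≤ e := Real.sqrt_nonneg _
  have ha0 : 0 < a := by linarith
  have hG := T.inviscid_symm l hr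
  set g := T.inviscid l r u with hg
  have gI : ∀ y, reInner (Complex.I • (A : ℂ) • g) y = A * reInner (Complex.I • g) y := by
    intro y; rw [smul_comm, reInner.smul_left]
  -- first-order energy identity
  have i1 : reInner f u = ‖u₁‖ ^ 2 + t * ‖u‖ ^ 2 := by
    have h1 := re_D hu₁ hu
    rw [hf, reInner.add_left, reInner.sub_left, gI, reInner.I_smul_symm hG, reInner.smul_left, h1,
      reInner.self, reInner.self]
    ring
  have i2 : T.energy a l r u₁ = reInner f (T.weight a l r u) + a ^ 2 * reInner u₁ (T.c u)
      - t * T.energy a l r u := by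
    have h1 := re_D hu₁ (D_weight a l hr hu)
    -- The weight is a combination of `1` and `G`, and `i G u` is orthogonal, for the real inner
    -- product, to both `u` and `G u`.
    have h2 : reInner (Complex.I • g) (T.weight a l r u) = 0 := by
      have h3 : reInner (Complex.I • g) g = 0 := by rw [reInner.symm, reInner.I_self]
      rw [weight_apply, reInner.sub_right, reInner.smul_right, reInner.smul_right,
        reInner.I_smul_symm hG, h3]
      ring
    rw [reInner.sub_right, reInner.smul_right, reInner.symm u₁ (T.weight a l r u₁)] at h1
    rw [hf, reInner.add_left, reInner.sub_left, gI, h2, reInner.smul_left, h1,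
      reInner.symm u]
    unfold energy
    ring
  have i3 : ‖u₂‖ ^ 2 = -reInner f u₂ - A * reInner (Complex.I • T.c u) u₁ - t * ‖u₁‖ ^ 2 := by
    have h1 := re_D hu hu₁
    have h2 := re_D (T.D_smul Complex.I (D_inviscid l hr hu)) hu₁
    rw [smul_add, reInner.add_left, reInner.I_smul_symm hG] at h2
    rw [hf, reInner.add_left, reInner.sub_left, gI, reInner.smul_left, ← reInner.self u₁, h1,
      ← reInner.self u₂]
    linear_combination A * h2
  set M := reInner g (T.s u - T.c u₁ - ((1 / 2 : ℝ) : ℂ) • u) with hM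
  -- Pairing the equation with `i` times the multiplier isolates `A * M`; every other term is a
  -- product of quantities bounded below.
  have i4 : A * M = reInner f (Complex.I • T.s u) - reInner (T.c f) (Complex.I • u₁)
      - 1 / 2 * reInner f (Complex.I • u) - reInner u₁ (Complex.I • T.c u)
      - reInner u₂ (Complex.I • T.c u₁) + t * reInner (T.c u) (Complex.I • u₁) := by
    have j1 : reInner f (Complex.I • (T.s u - T.c u₁ - ((1 / 2 : ℝ) : ℂ) • u)) = A * M
        - reInner u₂ (Complex.I • (T.s u - T.c u₁ - ((1 / 2 : ℝ) : ℂ) • u))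
        + t * reInner u (Complex.I • (T.s u - T.c u₁ - ((1 / 2 : ℝ) : ℂ) • u)) := by
      have : ∀ y, reInner (Complex.I • g) (Complex.I • y) = reInner g y := by
        intro y
        rw [reInner.I_left, smul_smul, Complex.I_mul_I, neg_one_smul, reInner.neg_right, neg_neg]
      rw [hM, ← this, ← gI, ← reInner.smul_left, ← reInner.sub_left, ← reInner.add_left, ← hf]
    have j2 : reInner u₂ (Complex.I • T.s u) = -reInner u₁ (Complex.I • T.c u) := by
      have h1 := re_D hu₁ (T.D_smul Complex.I (T.D_s hu))
      have h2 := reInner.I_smul_symm T.s_symm u₁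
      rw [reInner.symm] at h2
      rw [h1, smul_add, reInner.add_right, h2, zero_add]
    have j3 : reInner u₂ (Complex.I • u) = 0 := by
      rw [re_D hu₁ (T.D_smul Complex.I hu), reInner.I_self, neg_zero]
    have j4 : reInner u (Complex.I • T.s u) = 0 := by
      rw [reInner.symm, reInner.I_smul_symm T.s_symm]
    have j5 : ∀ x, reInner x (Complex.I • T.c u₁) = reInner (T.c x) (Complex.I • u₁) := by
      intro x
      rw [← T.re_c, map_smul]
    simp only [smul_sub, smul_comm Complex.I (((1 / 2 : ℝ) : ℂ)), reInner.sub_right,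
      reInner.smul_right, j2, j3, j4, reInner.I_self] at j1
    rw [j5 f, j5 u] at j1
    linarith
  have nI : ∀ y : H, ‖Complex.I • y‖ = ‖y‖ := fun y => by simp [norm_smul]
  have bF : ‖f‖ ≤ m * e := by
    refine le_of_sq_le_sq ?_ (by positivity)
    have := T.norm_sq_le_energy a hr hl f
    rw [mul_pow, he2]
    linarith
  have bn : ‖u‖ ≤ e := by
    refine le_of_sq_le_sq ?_ he0
    rw [he2]
    exact T.norm_sq_le_energy a hr hl u
  -- Here `3 / 2` is a rational bound for `√2`.
  have bC₀ : a * ‖T.c u‖ ≤ 3 / 2 * e := by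
    refine le_of_sq_le_sq ?_ (by positivity)
    have := T.norm_c_sq_le_energy a hr hl u
    nlinarith [sq_nonneg e]
  have bCf : a * ‖T.c f‖ ≤ 3 / 2 * (m * e) := by
    refine le_of_sq_le_sq ?_ (by positivity)
    have := T.norm_c_sq_le_energy a hr hl f
    have h2 : (m * e) ^ 2 = m ^ 2 * T.energy a l r u := by rw [mul_pow, he2]
    nlinarith [sq_nonneg (m * e)]
  obtain ⟨hP, hX⟩ := commutator_bounds hr hl hu
  rw [← hg, ← hM] at hP hX
  have hM0 : 0 ≤ M := by linarith [T.formP_nonneg u]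
  have hAM : a ^ 4 * M = |A * M| := by rw [abs_mul, hA, abs_of_nonneg hM0]
  have hzero : e = 0 := by
    refine eq_zero_of_hypocoercive_bounds ha he0 (norm_nonneg u) (norm_nonneg u₁)
      (norm_nonneg (T.c u₁)) (norm_nonneg f) bF bn bC₀ bCf (U₂ := ‖u₂‖)
      (M := M) ?_ ?_ ?_ ?_ hX hP ?_ ?_
    · have := reInner.le f u
      have : 0 ≤ t * ‖u‖ ^ 2 := by positivity
      linarith
    · have h1 := T.norm_c_sq_le_energy a hr hl u₁
      have h2 := T.re_weight_le a hr hl hm0 f u hfe le_rfl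
      have h3 := mul_le_mul_of_nonneg_left (reInner.le u₁ (T.c u)) (sq_nonneg a)
      have h4 := mul_nonneg ht0 (T.energy_nonneg a hr hl u)
      rw [← he2] at h2
      rw [hm] at h2
      linarith
    · have h1 := reInner.neg_le f u₂
      have h2 : -(A * reInner (Complex.I • T.c u) u₁) ≤ a ^ 4 * (‖T.c u‖ * ‖u₁‖) := by
        refine (neg_le_abs _).trans ?_
        rw [abs_mul, hA, ← nI (T.c u)]
        exact mul_le_mul_of_nonneg_left (reInner.abs_le _ _) (by positivity)
      have h3 : 0 ≤ t * ‖u₁‖ ^ 2 := by positivity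
      linarith
    · have b1 := reInner.abs_le f (Complex.I • T.s u)
      have b2 := reInner.abs_le (T.c f) (Complex.I • u₁)
      have b3 := reInner.abs_le f (Complex.I • u)
      have b4 := reInner.abs_le u₁ (Complex.I • T.c u)
      have b5 := reInner.abs_le u₂ (Complex.I • T.c u₁)
      have b6 := reInner.abs_le (T.c u) (Complex.I • u₁)
      rw [nI] at b1 b2 b3 b4 b5 b6
      have b7 := mul_le_mul_of_nonneg_left (T.norm_s_le u) (norm_nonneg f)
      have b8 : |t * reInner (T.c u) (Complex.I • u₁)| ≤ ‖T.c u‖ * ‖u₁‖ := by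
        rw [abs_mul, abs_of_nonneg ht0]
        exact (mul_le_of_le_one_left (abs_nonneg _) ht1).trans b6
      rw [mul_comm ‖u₁‖] at b4
      rw [hAM, i4]
      rw [abs_le] at b1 b2 b3 b4 b5 b8
      refine abs_le.2 ⟨by linarith [b1.1, b2.2, b3.2, b4.2, b5.2, b8.1],
        by linarith [b1.2, b2.1, b3.1, b4.1, b5.1, b8.2]⟩
    -- The uncertainty inequality: `‖u‖² = formP u + ⟨s u, u⟩`, and integrating `(c u)'` against `u`
    -- gives `⟨s u, u⟩ = 2 Re ⟨c u, u₁⟩`.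
    · have h2 := re_D (T.D_c hu) hu
      have e2 := T.re_c_symm u u₁
      have h3 := reInner.le (T.c u) u₁
      have h4 : T.formP u = ‖u‖ ^ 2 - reInner (T.s u) u := by
        rw [formP, reInner.sub_left, reInner.self]
      rw [reInner.sub_left] at h2
      linarith
    · rw [he2, T.energy_eq a l hr]
  rw [← he2, hzero] at hlt
  have := T.energy_nonneg a hr hl f
  norm_num at hlt
  linarith

end TrigCalculus

/-! ### From the energy norm to the Hilbert norm. -/

theorem le_of_forall_pow_two_pow_le_mul {x y C : ℝ} (hy : 0 ≤ y)
    (h : ∀ n : ℕ, x ^ 2 ^ n ≤ C * y ^ 2 ^ n) : x ≤ y := by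
  by_contra! hxy
  rcases hy.eq_or_lt with rfl | hy
  · have := h 0
    simp at this
    linarith
  · have h1 : 1 < x / y := (one_lt_div hy).2 hxy
    have h2 := (tendsto_pow_atTop_atTop_of_one_lt h1).comp
      (tendsto_pow_atTop_atTop_of_one_lt (one_lt_two : (1 : ℕ) < 2))
    obtain ⟨n, hn⟩ := (h2.eventually_gt_atTop C).exists
    have := h n
    rw [← div_le_iff₀ (by positivity), ← div_pow] at this
    exact absurd hn (not_lt.2 this)

/-- Krein's symmetrization argument: if an operator and its adjoint are bounded by `k` in an
equivalent norm, then so is the operator in the Hilbert norm. -/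
theorem ContinuousLinearMap.norm_apply_le_of_equivalent_bounds {H : Type*} [NormedAddCommGroup H]
    [InnerProductSpace ℂ H] [CompleteSpace H] (R : H →L[ℂ] H) (E : H → ℝ) {k C : ℝ} (hk : 0 ≤ k)
    (hC : 0 ≤ C) (hlow : ∀ x, ‖x‖ ^ 2 ≤ E x) (hup : ∀ x, E x ≤ C ^ 2 * ‖x‖ ^ 2)
    (h1 : ∀ x, E (R x) ≤ k ^ 2 * E x) (h2 : ∀ x, E (adjoint R x) ≤ k ^ 2 * E x) (x : H) :
    ‖R x‖ ≤ k * ‖x‖ := by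
  set S : H →L[ℂ] H := star R * R with hS
  have hSE : ∀ x, E (S x) ≤ (k ^ 2) ^ 2 * E x := by
    intro x
    calc E (S x) ≤ k ^ 2 * E (R x) := h2 (R x)
      _ ≤ k ^ 2 * (k ^ 2 * E x) := mul_le_mul_of_nonneg_left (h1 x) (sq_nonneg k)
      _ = _ := by ring
  have hpow : ∀ (n : ℕ) x, E ((S ^ n) x) ≤ ((k ^ 2) ^ n) ^ 2 * E x := by
    intro n
    induction n with
    | zero => intro x; simp
    | succ n ih =>
      intro x
      calc E ((S ^ (n + 1)) x) = E (S ((S ^ n) x)) := by rw [pow_succ']; rfl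
        _ ≤ (k ^ 2) ^ 2 * E ((S ^ n) x) := hSE _
        _ ≤ (k ^ 2) ^ 2 * (((k ^ 2) ^ n) ^ 2 * E x) :=
          mul_le_mul_of_nonneg_left (ih x) (by positivity)
        _ = _ := by ring
  have hnorm : ∀ n : ℕ, ‖S ^ n‖ ≤ C * (k ^ 2) ^ n := by
    intro n
    refine ContinuousLinearMap.opNorm_le_bound _ (by positivity) fun x => ?_
    refine le_of_sq_le_sq ?_ (by positivity)
    calc ‖(S ^ n) x‖ ^ 2 ≤ E ((S ^ n) x) := hlow _
      _ ≤ ((k ^ 2) ^ n) ^ 2 * E x := hpow n x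
      _ ≤ ((k ^ 2) ^ n) ^ 2 * (C ^ 2 * ‖x‖ ^ 2) :=
        mul_le_mul_of_nonneg_left (hup x) (by positivity)
      _ = _ := by ring
  have hSsa : IsSelfAdjoint S := IsSelfAdjoint.star_mul_self R
  have hle : ‖S‖ ≤ k ^ 2 := by
    -- For self-adjoint `S`, `‖S ^ 2 ^ n‖ = ‖S‖ ^ 2 ^ n`; in the limit the equivalence constant `C`
    -- is lost.
    refine le_of_forall_pow_two_pow_le_mul (C := C) (sq_nonneg k) fun n => ?_
    have := congrArg NNReal.toReal (hSsa.nnnorm_pow_two_pow n)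
    simp only [coe_nnnorm, NNReal.coe_pow] at this
    rw [← this]
    exact hnorm _
  rw [hS, CStarRing.norm_star_mul_self] at hle
  have hR : ‖R‖ ≤ k := le_of_sq_le_sq (by rw [sq]; exact hle) hk
  exact (R.le_opNorm x).trans (mul_le_mul_of_nonneg_right hR (norm_nonneg x))

/-- The spectrum of `Y` is real, and `1 + i Y = -i (i - Y)`. -/
theorem IsSelfAdjoint.isUnit_one_add_I_smul {B : Type*} [CStarAlgebra B] {Y : B}
    (hY : IsSelfAdjoint Y) : IsUnit (1 + Complex.I • Y) := by
  have hI : Complex.I ∉ spectrum ℂ Y := by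
    intro h
    have := congrArg Complex.im (hY.mem_spectrum_eq_re h)
    simp at this
  rw [spectrum.notMem_iff] at hI
  have hu : IsUnit ((-Complex.I) • (algebraMap ℂ B Complex.I - Y)) :=
    hI.smul (Units.mk0 (-Complex.I) (by simp))
  convert hu using 1
  rw [smul_sub, Algebra.algebraMap_eq_smul_one, smul_smul]
  simp

/-! ### The resolvent and its adjoint. -/

namespace TrigCalculus

variable {H : Type*} [NormedAddCommGroup H] [InnerProductSpace ℂ H] {T : TrigCalculus H}

/-- `u` solves `i A G u - u'' + t u = f`, where `G` is the inviscid operator. -/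
def SolvesResolvent (T : TrigCalculus H) (l r t A : ℝ) (u f : H) : Prop :=
  ∃ u₁ u₂, T.D u u₁ ∧ T.D u₁ u₂ ∧
    f = Complex.I • (A : ℂ) • T.inviscid l r u - u₂ + (t : ℂ) • u

/-- The inviscid operator, conjugated by `(t - ∂²)^{-1/2}`. -/
noncomputable def conjInviscid (T : TrigCalculus H) (l r t : ℝ) : H →L[ℂ] H :=
  (T.Q t).comp ((T.inviscid l r).comp (T.Q t))

/-- With `u = Q w`, applying `Q = (t - ∂²)^(-1/2)` to the equation turns it into `(1 + i A Q G Q) w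
= Q f`, which involves bounded operators only. A right inverse gives existence; uniqueness comes
from a left inverse. -/
theorem solvesResolvent_of_inverse {l r t A : ℝ} (ht : 0 < t) {C : H →L[ℂ] H}
    (hC : (1 + Complex.I • (A : ℂ) • T.conjInviscid l r t) * C = 1) (f : H) :
    T.SolvesResolvent l r t A (T.Q t (C (T.Q t f))) f := by
  set w := C (T.Q t f) with hw
  set u := T.Q t w with hu
  have h1 : w + Complex.I • (A : ℂ) • T.Q t (T.inviscid l r u) = T.Q t f := by
    have := congrArg (fun B : H →L[ℂ] H => B (T.Q t f)) hC
    simpa [conjInviscid] using this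
  set h := f - Complex.I • (A : ℂ) • T.inviscid l r u with hh
  have h2 : T.Q t (T.Q t h) = u := by
    rw [hh, map_sub, map_smul, map_smul, ← h1, add_sub_cancel_right]
  obtain ⟨p, hp, hp'⟩ := T.resolvent ht h
  rw [h2] at hp hp'
  refine ⟨p, _, hp, hp', ?_⟩
  rw [hh]
  abel

theorem inverse_apply_of_solvesResolvent {l r t A : ℝ} (ht : 0 < t) {C : H →L[ℂ] H}
    (hC : C * (1 + Complex.I • (A : ℂ) • T.conjInviscid l r t) = 1) {u f : H}
    (h : T.SolvesResolvent l r t A u f) : T.Q t (C (T.Q t f)) = u := by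
  obtain ⟨u₁, u₂, hu, hu₁, rfl⟩ := h
  have h1 := T.resolvent_left ht hu hu₁
  set v := T.Q t ((t : ℂ) • u - u₂) with hv
  have h2 : T.Q t (Complex.I • (A : ℂ) • T.inviscid l r u - u₂ + (t : ℂ) • u)
      = (1 + Complex.I • (A : ℂ) • T.conjInviscid l r t) v := by
    have : Complex.I • (A : ℂ) • T.inviscid l r u - u₂ + (t : ℂ) • u
        = ((t : ℂ) • u - u₂) + Complex.I • (A : ℂ) • T.inviscid l r u := by abel
    rw [this, map_add, ← hv]
    simp [conjInviscid, h1]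
  have h3 := congrArg (fun B : H →L[ℂ] H => B v) hC
  simp only [mul_apply_eq_comp, one_apply_eq_self] at h3
  rw [h2, h3, h1]

theorem exists_resolvent [CompleteSpace H] (T : TrigCalculus H) (l A : ℝ) {r t : ℝ} (hr : 0 < r)
    (ht : 0 < t) : ∃ R : H →L[ℂ] H, (∀ f, T.SolvesResolvent l r t A (R f) f) ∧
      (∀ f, T.SolvesResolvent l r t (-A) (ContinuousLinearMap.adjoint R f) f) ∧
      ∀ u f, T.SolvesResolvent l r t A u f → R f = u := by
  have hQ : ContinuousLinearMap.adjoint (T.Q t) = T.Q t :=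
    ((ContinuousLinearMap.eq_adjoint_iff _ _).2 (T.Q_symm ht)).symm
  have hX : IsSelfAdjoint (T.conjInviscid l r t) := by
    refine ((ContinuousLinearMap.eq_adjoint_iff _ _).2 fun x y => ?_).symm
    simp only [conjInviscid, ContinuousLinearMap.comp_apply]
    rw [T.Q_symm ht, T.inviscid_symm l hr, T.Q_symm ht]
  have hAX : IsSelfAdjoint ((A : ℂ) • T.conjInviscid l r t) :=
    IsSelfAdjoint.smul (by simp [IsSelfAdjoint]) hX
  obtain ⟨B, hB⟩ := hAX.isUnit_one_add_I_smul
  set C : H →L[ℂ] H := ↑B⁻¹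
  have hC₁ : (1 + Complex.I • (A : ℂ) • T.conjInviscid l r t) * C = 1 := by
    rw [← hB]; exact B.mul_inv
  have hC₂ : C * (1 + Complex.I • (A : ℂ) • T.conjInviscid l r t) = 1 := by
    rw [← hB]; exact B.inv_mul
  -- Taking adjoints replaces `A` by `-A` and turns the left inverse into a right inverse, so the
  -- adjoint of `R` solves the equation for `-A`.
  have hC₃ : (1 + Complex.I • ((-A : ℝ) : ℂ) • T.conjInviscid l r t) * star C = 1 := by
    have := congrArg star hC₂
    rw [star_mul, star_add, star_smul, star_one, hAX.star_eq] at this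
    simpa using this
  refine ⟨(T.Q t).comp (C.comp (T.Q t)), fun f => solvesResolvent_of_inverse ht hC₁ f,
    fun f => ?_, fun u f h => inverse_apply_of_solvesResolvent ht hC₂ h⟩
  have := solvesResolvent_of_inverse ht hC₃ f
  rwa [ContinuousLinearMap.adjoint_comp, ContinuousLinearMap.adjoint_comp, hQ]

theorem norm_le_of_solvesResolvent_of_nonneg [CompleteSpace H] (T : TrigCalculus H)
    {a l r t A : ℝ} (ha : 1 ≤ a) (hl : 0 ≤ l) (hr : 0 < r) (ht0 : 0 < t) (ht1 : t ≤ 1)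
    (hA : |A| = a ^ 4) {u f : H} (h : T.SolvesResolvent l r t A u f) :
    a ^ 2 / 20736 * ‖u‖ ≤ ‖f‖ := by
  obtain ⟨R, h1, h2, h3⟩ := T.exists_resolvent l A hr ht0
  have hm : 0 < a ^ 2 / 20736 := by positivity
  have key : ∀ A' : ℝ, |A'| = a ^ 4 → ∀ {v g}, T.SolvesResolvent l r t A' v g →
      T.energy a l r v ≤ ((a ^ 2 / 20736)⁻¹) ^ 2 * T.energy a l r g := by
    rintro A' hA' v g ⟨v₁, v₂, hv, hv₁, hg⟩
    have := energy_le_energy ha hl hr ht0.le ht1 hA' hv hv₁ hg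
    rw [inv_pow, ← div_eq_inv_mul, le_div_iff₀ (by positivity), mul_comm]
    exact this
  have hup : ∀ x, T.energy a l r x ≤ Real.sqrt ‖T.weight a l r‖ ^ 2 * ‖x‖ ^ 2 := by
    intro x
    rw [Real.sq_sqrt (norm_nonneg _)]
    calc T.energy a l r x ≤ ‖T.weight a l r x‖ * ‖x‖ := reInner.le _ _
      _ ≤ (‖T.weight a l r‖ * ‖x‖) * ‖x‖ :=
        mul_le_mul_of_nonneg_right ((T.weight a l r).le_opNorm x) (norm_nonneg x)
      _ = _ := by ring
  have := R.norm_apply_le_of_equivalent_bounds (T.energy a l r) (inv_nonneg.2 hm.le)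
    (Real.sqrt_nonneg _) (T.norm_sq_le_energy a hr hl) hup (fun x => key A hA (h1 x))
    (fun x => key (-A) (by rwa [abs_neg]) (h2 x)) f
  rwa [h3 u f h, ← div_eq_inv_mul, le_div_iff₀ hm, mul_comm] at this

theorem SolvesResolvent.halfShift {l r t A : ℝ} {u f : H} (h : T.SolvesResolvent l r t A u f) :
    T.halfShift.SolvesResolvent (-l) r t (-A) u f := by
  obtain ⟨u₁, u₂, hu, hu₁, hf⟩ := h
  refine ⟨u₁, u₂, hu, hu₁, ?_⟩
  have : T.halfShift.inviscid (-l) r u = -T.inviscid l r u := by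
    simp only [inviscid_apply, TrigCalculus.halfShift]
    simp only [neg_apply, Complex.ofReal_neg, neg_smul]
    abel
  rw [hf, this]
  simp

/-- The resolvent estimate in the Hilbert norm. -/
theorem norm_le_of_solvesResolvent [CompleteSpace H] (T : TrigCalculus H)
    {a l r A : ℝ} (ha : 1 ≤ a) (hr : 0 < r) (hA : |A| = a ^ 4) {u f : H}
    (h : T.SolvesResolvent l r 0 A u f) : a ^ 2 / 41472 * ‖u‖ ≤ ‖f‖ := by
  -- Existence of the resolvent needs `t > 0`. Half of `1 / 20736` is chosen, so that by `1 ≤ a` the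
  -- added term costs at most half of the bound.
  have h' : T.SolvesResolvent l r (1 / 41472) A u (f + ((1 / 41472 : ℝ) : ℂ) • u) := by
    obtain ⟨u₁, u₂, hu, hu₁, hf⟩ := h
    exact ⟨u₁, u₂, hu, hu₁, by rw [hf]; simp⟩
  have key : a ^ 2 / 20736 * ‖u‖ ≤ ‖f + ((1 / 41472 : ℝ) : ℂ) • u‖ := by
    rcases le_total 0 l with hl | hl
    · exact T.norm_le_of_solvesResolvent_of_nonneg ha hl hr (by norm_num) (by norm_num) hA h'
    · exact T.halfShift.norm_le_of_solvesResolvent_of_nonneg ha (neg_nonneg.2 hl) hr (by norm_num)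
        (by norm_num) (by rwa [abs_neg]) h'.halfShift
  have h2 := norm_add_le f (((1 / 41472 : ℝ) : ℂ) • u)
  rw [norm_smul, Complex.norm_real, Real.norm_of_nonneg (by norm_num)] at h2
  have h3 : ‖u‖ ≤ a ^ 2 * ‖u‖ := le_mul_of_one_le_left (norm_nonneg u) (one_le_pow₀ ha)
  linarith

end TrigCalculus

/-! ### The calculus on Fourier coefficients. -/

/-- Square summable two-sided sequences: the Fourier coefficients of `L²(𝕋)`. -/
noncomputable abbrev EllTwo := lp (fun _ : ℤ => ℂ) 2

namespace EllTwo

theorem norm_sq (x : EllTwo) : HasSum (fun k => ‖x k‖ ^ 2) (‖x‖ ^ 2) := by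
  have := lp.hasSum_norm (p := 2) (by norm_num) x
  simpa using this

theorem memℓp_mul_shift {m : ℤ → ℂ} {C : ℝ} (hm : ∀ k, ‖m k‖ ≤ C) (j : ℤ) (x : EllTwo) :
    Memℓp (fun k => m k * x (k + j)) 2 := by
  refine memℓp_gen ?_
  have h : Summable fun k => C ^ 2 * ‖x (k + j)‖ ^ 2 :=
    ((Equiv.addRight j).summable_iff.2 (norm_sq x).summable).mul_left _
  refine Summable.of_nonneg_of_le (fun k => by positivity) (fun k => ?_) h
  simp only [ENNReal.toReal_ofNat, Real.rpow_ofNat, norm_mul, mul_pow]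
  gcongr
  exact hm k

/-- The operator `(x k)ₖ ↦ (m k * x (k + j))ₖ` with a bounded multiplier `m`. -/
noncomputable def mulShift (m : ℤ → ℂ) (C : ℝ) (hm : ∀ k, ‖m k‖ ≤ C) (j : ℤ) :
    EllTwo →L[ℂ] EllTwo :=
  LinearMap.mkContinuous
    { toFun := fun x => ⟨fun k => m k * x (k + j), memℓp_mul_shift hm j x⟩
      map_add' := fun x y => by
        ext k
        exact mul_add (m k) (x (k + j)) (y (k + j))
      map_smul' := fun a x => by
        ext k
        exact mul_left_comm (m k) a (x (k + j)) } C <| fun x => by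
    have hC : 0 ≤ C := (norm_nonneg _).trans (hm 0)
    refine le_of_sq_le_sq ?_ (by positivity)
    have h : HasSum (fun k => C ^ 2 * ‖x (k + j)‖ ^ 2) (C ^ 2 * ‖x‖ ^ 2) :=
      ((Equiv.addRight j).hasSum_iff.2 (norm_sq x)).mul_left _
    rw [mul_pow]
    refine hasSum_le (fun k => ?_) (norm_sq _) h
    simp only [LinearMap.coe_mk, AddHom.coe_mk, norm_mul, mul_pow]
    gcongr
    exact hm k

@[simp]
theorem mulShift_apply (m : ℤ → ℂ) (C : ℝ) (hm : ∀ k, ‖m k‖ ≤ C) (j : ℤ) (x : EllTwo) (k : ℤ) :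
    mulShift m C hm j x k = m k * x (k + j) := rfl

theorem inner_eq (x y : EllTwo) : inner ℂ x y = ∑' k, y k * (starRingEnd ℂ) (x k) := by
  rw [lp.inner_eq_tsum]
  rfl

/-- The shift of sequences. -/
noncomputable def shift (j : ℤ) : EllTwo →L[ℂ] EllTwo := mulShift (fun _ => 1) 1 (by simp) j

@[simp]
theorem shift_apply (j : ℤ) (x : EllTwo) (k : ℤ) : shift j x k = x (k + j) := by
  simp [shift]

theorem inner_shift (j : ℤ) (x y : EllTwo) : inner ℂ (shift j x) y = inner ℂ x (shift (-j) y) := by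
  rw [inner_eq, inner_eq, ← (Equiv.addRight j).tsum_eq (fun k => shift (-j) y k * _)]
  simp

/-- The Fourier multiplier with symbol `m`. -/
noncomputable def diag (m : ℤ → ℝ) (C : ℝ) (hm : ∀ k, |m k| ≤ C) : EllTwo →L[ℂ] EllTwo :=
  mulShift (fun k => m k) C (by simpa using hm) 0

@[simp]
theorem diag_apply (m : ℤ → ℝ) (C : ℝ) (hm : ∀ k, |m k| ≤ C) (x : EllTwo) (k : ℤ) :
    diag m C hm x k = m k * x k := by
  simp [diag]

theorem inner_diag (m : ℤ → ℝ) (C : ℝ) (hm : ∀ k, |m k| ≤ C) (x y : EllTwo) :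
    inner ℂ (diag m C hm x) y = inner ℂ x (diag m C hm y) := by
  rw [inner_eq, inner_eq]
  refine tsum_congr fun k => ?_
  simp only [diag_apply, map_mul, Complex.conj_ofReal]
  ring

/-- The symbol of `(r - ∂²)^{-1/2}`. -/
noncomputable def besselSymbol (r : ℝ) (k : ℤ) : ℝ := if 0 < r then 1 / √((k : ℝ) ^ 2 + r) else 0

theorem abs_besselSymbol_le (r : ℝ) (k : ℤ) : |besselSymbol r k| ≤ 1 / √r := by
  unfold besselSymbol
  split_ifs with hr
  · rw [abs_of_nonneg (by positivity)]
    refine one_div_le_one_div_of_le (Real.sqrt_pos.2 hr) (Real.sqrt_le_sqrt ?_)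
    nlinarith [sq_nonneg (k : ℝ)]
  -- For `r ≤ 0` the bound is `1 / √r = 1 / 0 = 0`, which the default value `0` of the symbol meets.
  · simp

theorem besselSymbol_mul_self {r : ℝ} (hr : 0 < r) (k : ℤ) :
    besselSymbol r k * besselSymbol r k = 1 / ((k : ℝ) ^ 2 + r) := by
  rw [besselSymbol, if_pos hr, div_mul_div_comm, Real.mul_self_sqrt (by positivity), one_mul]

/-- The operator `(r - ∂²)^{-1/2}`. -/
noncomputable def bessel (r : ℝ) : EllTwo →L[ℂ] EllTwo :=
  diag (besselSymbol r) _ (abs_besselSymbol_le r)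

theorem bessel_bessel_apply {r : ℝ} (hr : 0 < r) (x : EllTwo) (k : ℤ) :
    bessel r (bessel r x) k = x k / ((k : ℂ) ^ 2 + r) := by
  have := congrArg Complex.ofReal (besselSymbol_mul_self hr k)
  push_cast at this
  rw [bessel, diag_apply, diag_apply, ← mul_assoc, this]
  ring

theorem sq_add_ne_zero {r : ℝ} (hr : 0 < r) (k : ℤ) : (k : ℂ) ^ 2 + r ≠ 0 := by
  have : ((k : ℝ) ^ 2 + r) ≠ 0 := by positivity
  exact_mod_cast this

/-- This makes `∂ (r - ∂²)⁻¹` a bounded multiplier. The bound `1`, uniform in `r`, holds because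
`|k| ≤ k ^ 2` for integers. -/
theorem abs_div_sq_add_le {r : ℝ} (hr : 0 < r) (k : ℤ) : |(k : ℝ) / ((k : ℝ) ^ 2 + r)| ≤ 1 := by
  rw [abs_div, abs_of_pos (by positivity : 0 < (k : ℝ) ^ 2 + r), div_le_one (by positivity)]
  have : |(k : ℝ)| ≤ (k : ℝ) ^ 2 := by
    have h : |k| ≤ k ^ 2 := by
      rw [← sq_abs]
      nlinarith [Int.one_le_abs (z := k), abs_nonneg k]
    exact_mod_cast h
  linarith

theorem add_apply (x y : EllTwo) (k : ℤ) : (x + y) k = x k + y k := rfl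

theorem sub_apply (x y : EllTwo) (k : ℤ) : (x - y) k = x k - y k := rfl

theorem smul_apply (a : ℂ) (x : EllTwo) (k : ℤ) : (a • x) k = a * x k := rfl

/-- Multiplication by sine. -/
noncomputable def sine : EllTwo →L[ℂ] EllTwo := (-Complex.I / 2) • (shift (-1) - shift 1)

/-- Multiplication by cosine. -/
noncomputable def cosine : EllTwo →L[ℂ] EllTwo := (1 / 2 : ℂ) • (shift (-1) + shift 1)

theorem sine_apply (x : EllTwo) (k : ℤ) :
    sine x k = -Complex.I / 2 * (x (k - 1) - x (k + 1)) := by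
  change -Complex.I / 2 * (shift (-1) x k - shift 1 x k) = _
  rw [shift_apply, shift_apply, sub_eq_add_neg k]

theorem cosine_apply (x : EllTwo) (k : ℤ) : cosine x k = 1 / 2 * (x (k - 1) + x (k + 1)) := by
  change 1 / 2 * (shift (-1) x k + shift 1 x k) = _
  rw [shift_apply, shift_apply, sub_eq_add_neg k]

/-- The calculus of `L²(𝕋)` in terms of Fourier coefficients. -/
noncomputable def calculus : TrigCalculus EllTwo where
  s := sine
  c := cosine
  D x y := ∀ k : ℤ, y k = Complex.I * k * x k
  Q := bessel
  s_symm x y := by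
    simp [sine, inner_shift]
    ring
  c_symm x y := by
    simp [cosine, inner_shift]
    ring
  s_c x := by
    ext k
    simp only [sine_apply, cosine_apply]
    ring_nf
  c_c x := by
    ext k
    simp only [sine_apply, cosine_apply, sub_apply, sub_add_cancel, add_sub_cancel_right]
    linear_combination (1 / 4) * (x (k - 1 - 1) - 2 * x k + x (k + 1 + 1)) * Complex.I_sq
  D_skew {x x' y y'} hx hy := by
    rw [inner_eq, inner_eq, ← tsum_neg]
    refine tsum_congr fun k => ?_
    rw [hx, hy]
    simp
    ring
  D_s {x x'} h k := by
    simp only [sine_apply, cosine_apply, add_apply, h]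
    push_cast
    linear_combination (1 / 2) * (x (k - 1) + x (k + 1)) * Complex.I_sq
  D_c {x x'} h k := by
    simp only [sine_apply, cosine_apply, sub_apply, h]
    push_cast
    ring
  D_add {x x' y y'} hx hy k := by
    simp only [add_apply, hx k, hy k, mul_add]
  D_smul a {x x'} h k := by
    simp only [smul_apply, h k]
    ring
  Q_symm hr x y := inner_diag _ _ _ x y
  D_Q {r} hr {x x'} h k := by
    rw [bessel_bessel_apply hr, bessel_bessel_apply hr, h k]
    ring
  resolvent {r} hr x := by
    refine ⟨Complex.I • diag _ 1 (abs_div_sq_add_le hr) x, fun k => ?_, fun k => ?_⟩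
    · rw [bessel_bessel_apply hr, smul_apply, diag_apply]
      push_cast
      ring
    · have := sq_add_ne_zero hr k
      rw [sub_apply, smul_apply, bessel_bessel_apply hr, smul_apply, diag_apply]
      push_cast
      field_simp
      linear_combination (-(k : ℂ) ^ 2) * x k * Complex.I_sq
  resolvent_left {r} hr {x x' x''} h h' := by
    ext k
    have := sq_add_ne_zero hr k
    rw [bessel_bessel_apply hr, sub_apply, smul_apply, h' k, h k, div_eq_iff this]
    linear_combination (-(k : ℂ) ^ 2) * x k * Complex.I_sq

end EllTwo

/-! ### From functions on the circle to sequences. -/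

namespace MemL2T

variable {f g : ℝ → ℂ}

theorem add (hf : MemL2T f) (hg : MemL2T g) : MemL2T fun y => f y + g y :=
  ⟨hf.periodic.add hg.periodic, hf.memLp.add hg.memLp⟩

theorem sub (hf : MemL2T f) (hg : MemL2T g) : MemL2T fun y => f y - g y :=
  ⟨hf.periodic.sub hg.periodic, hf.memLp.sub hg.memLp⟩

theorem const_mul (a : ℂ) (hf : MemL2T f) : MemL2T fun y => a * f y :=
  ⟨fun y => by simp only [hf.periodic y], hf.memLp.const_mul a⟩

theorem sin_mul (hf : MemL2T f) : MemL2T fun y => ((Real.sin y : ℝ) : ℂ) * f y := by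
  refine ⟨fun y => by simp only [hf.periodic y, Real.sin_periodic y], hf.memLp.of_le ?_ ?_⟩
  · exact ((Complex.continuous_ofReal.comp Real.continuous_sin).aestronglyMeasurable).mul
      hf.memLp.aestronglyMeasurable
  · refine Filter.Eventually.of_forall fun y => ?_
    rw [norm_mul, Complex.norm_real, Real.norm_eq_abs]
    exact mul_le_of_le_one_left (norm_nonneg _) (Real.abs_sin_le_one y)

theorem intervalIntegrable (hf : MemL2T f) :
    IntervalIntegrable f volume 0 (2 * Real.pi) := by
  rw [intervalIntegrable_iff_integrableOn_Ioc_of_le Real.two_pi_pos.le]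
  exact hf.memLp.integrable (by norm_num)

end MemL2T

/-- The exponential `exp (-i k y)`. -/
noncomputable def expNeg (k : ℤ) (y : ℝ) : ℂ := Complex.exp (-(Complex.I * k * y))

theorem contDiff_expNeg (k : ℤ) : ContDiff ℝ ∞ (expNeg k) := by
  unfold expNeg
  exact ((contDiff_const.mul Complex.ofRealCLM.contDiff).neg).cexp

theorem periodic_expNeg (k : ℤ) : Function.Periodic (expNeg k) (2 * Real.pi) := by
  intro y
  unfold expNeg
  rw [Complex.exp_eq_exp_iff_exists_int]
  refine ⟨-k, ?_⟩
  push_cast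
  ring

theorem deriv_expNeg (k : ℤ) (y : ℝ) : deriv (expNeg k) y = -(Complex.I * k) * expNeg k y := by
  have h : HasDerivAt (fun y : ℝ => -(Complex.I * k * (y : ℂ))) (-(Complex.I * k * 1)) y :=
    ((Complex.ofRealCLM.hasDerivAt (x := y)).const_mul (Complex.I * (k : ℂ))).neg
  have h2 := h.cexp.deriv
  change deriv (fun y : ℝ => Complex.exp (-(Complex.I * k * (y : ℂ)))) y = _
  rw [h2, mul_one, mul_comm]
  rfl

theorem sin_mul_expNeg (k : ℤ) (y : ℝ) : ((Real.sin y : ℝ) : ℂ) * expNeg k y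
    = -Complex.I / 2 * (expNeg (k - 1) y - expNeg (k + 1) y) := by
  have h1 : expNeg (k - 1) y = expNeg k y * Complex.exp (y * Complex.I) := by
    unfold expNeg
    rw [← Complex.exp_add]
    congr 1
    push_cast
    ring
  have h2 : expNeg (k + 1) y = expNeg k y * Complex.exp (-y * Complex.I) := by
    unfold expNeg
    rw [← Complex.exp_add]
    congr 1
    push_cast
    ring
  rw [h1, h2, Complex.ofReal_sin, Complex.sin]
  ring

/-- Fourier coefficients over one period. -/
noncomputable def coeffT (f : ℝ → ℂ) (k : ℤ) : ℂ := fourierCoeffOn Real.two_pi_pos f k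

theorem coeffT_eq (f : ℝ → ℂ) (k : ℤ) : coeffT f k =
    ((1 / (2 * Real.pi) : ℝ) : ℂ) * ∫ y in (0 : ℝ)..(2 * Real.pi), f y * expNeg k y := by
  rw [coeffT, fourierCoeffOn_eq_integral, Complex.real_smul, sub_zero]
  congr 1
  refine intervalIntegral.integral_congr fun y _ => ?_
  simp only [fourier_coe_apply, smul_eq_mul]
  rw [mul_comm]
  congr 1
  unfold expNeg
  congr 1
  have : (Real.pi : ℂ) ≠ 0 := by exact_mod_cast Real.pi_ne_zero
  push_cast
  field_simp

theorem memℓp_coeffT {f : ℝ → ℂ} (hf : MemL2T f) : Memℓp (coeffT f) 2 := by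
  refine memℓp_gen ?_
  simpa [coeffT] using (hasSum_sq_fourierCoeffOn Real.two_pi_pos hf.memLp).summable

/-- The sequence of Fourier coefficients of an element of `L²(𝕋)`. -/
noncomputable def MemL2T.seq {f : ℝ → ℂ} (hf : MemL2T f) : EllTwo := ⟨coeffT f, memℓp_coeffT hf⟩

theorem MemL2T.seq_apply {f : ℝ → ℂ} (hf : MemL2T f) (k : ℤ) : hf.seq k = coeffT f k := rfl

theorem MemL2T.l2NormT_eq {f : ℝ → ℂ} (hf : MemL2T f) :
    l2NormT f = √(2 * Real.pi) * ‖hf.seq‖ := by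
  have h := (EllTwo.norm_sq hf.seq).unique (hasSum_sq_fourierCoeffOn Real.two_pi_pos hf.memLp)
  have hpi : (0 : ℝ) < 2 * Real.pi := Real.two_pi_pos
  rw [smul_eq_mul, sub_zero, eq_inv_mul_iff_mul_eq₀ hpi.ne'] at h
  rw [l2NormT, ← h, Real.sqrt_mul hpi.le, Real.sqrt_sq (norm_nonneg _)]

theorem MemL2T.intervalIntegrable_mul_expNeg {f : ℝ → ℂ} (hf : MemL2T f) (k : ℤ) :
    IntervalIntegrable (fun y => f y * expNeg k y) volume 0 (2 * Real.pi) :=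
  hf.intervalIntegrable.mul_continuousOn (contDiff_expNeg k).continuous.continuousOn

theorem MemL2T.seq_add {f g : ℝ → ℂ} (hf : MemL2T f) (hg : MemL2T g) :
    (hf.add hg).seq = hf.seq + hg.seq := by
  ext k
  rw [EllTwo.add_apply]
  simp only [MemL2T.seq_apply, coeffT_eq, add_mul]
  rw [intervalIntegral.integral_add (hf.intervalIntegrable_mul_expNeg k)
    (hg.intervalIntegrable_mul_expNeg k)]
  ring

theorem MemL2T.seq_const_mul {f : ℝ → ℂ} (a : ℂ) (hf : MemL2T f) :
    (hf.const_mul a).seq = a • hf.seq := by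
  ext k
  rw [EllTwo.smul_apply]
  simp only [MemL2T.seq_apply, coeffT_eq, mul_assoc]
  rw [intervalIntegral.integral_const_mul]
  ring

theorem MemL2T.seq_sub {f g : ℝ → ℂ} (hf : MemL2T f) (hg : MemL2T g) :
    (hf.sub hg).seq = hf.seq - hg.seq := by
  ext k
  rw [EllTwo.sub_apply]
  simp only [MemL2T.seq_apply, coeffT_eq, sub_mul]
  rw [intervalIntegral.integral_sub (hf.intervalIntegrable_mul_expNeg k)
    (hg.intervalIntegrable_mul_expNeg k)]
  ring

theorem MemL2T.seq_sin_mul {f : ℝ → ℂ} (hf : MemL2T f) :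
    hf.sin_mul.seq = EllTwo.calculus.s hf.seq := by
  ext k
  change _ = EllTwo.sine hf.seq k
  rw [EllTwo.sine_apply]
  simp only [MemL2T.seq_apply, coeffT_eq]
  have h : ∀ y : ℝ, ((Real.sin y : ℝ) : ℂ) * f y * expNeg k y
      = -Complex.I / 2 * (f y * expNeg (k - 1) y - f y * expNeg (k + 1) y) := by
    intro y
    linear_combination f y * sin_mul_expNeg k y
  simp only [h]
  rw [intervalIntegral.integral_const_mul, intervalIntegral.integral_sub
    (hf.intervalIntegrable_mul_expNeg _) (hf.intervalIntegrable_mul_expNeg _)]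
  ring

theorem MemL2T.seq_congr {f g : ℝ → ℂ} (hf : MemL2T f) (hg : MemL2T g)
    (h : ∀ᵐ y : ℝ, f y = g y) : hf.seq = hg.seq := by
  ext k
  exact congrFun (fourierCoeffOn_congr_ae Real.two_pi_pos (ae_restrict_of_ae h)) k

/-- Exponentials are admissible test functions, and testing with them is enough. -/
theorem HasWeakDerivT.seq {f g : ℝ → ℂ} (hf : MemL2T f) (hg : MemL2T g)
    (h : HasWeakDerivT f g) : EllTwo.calculus.D hf.seq hg.seq := by
  intro k
  have := h (expNeg k) (contDiff_expNeg k) (periodic_expNeg k)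
  have h2 : ∀ y : ℝ, f y * deriv (expNeg k) y = -(Complex.I * k) * (f y * expNeg k y) := by
    intro y
    rw [deriv_expNeg]
    ring
  simp only [h2] at this
  rw [intervalIntegral.integral_const_mul] at this
  simp only [MemL2T.seq_apply, coeffT_eq]
  linear_combination ((1 / (2 * Real.pi) : ℝ) : ℂ) * this

/-! ### The reduced and the full operator with the viscosity scaled out. -/

namespace TrigCalculus

variable {H : Type*} [NormedAddCommGroup H] [InnerProductSpace ℂ H] {T : TrigCalculus H}

/-- The second derivative is bounded by the Helmholtz operator. -/
theorem norm_helmholtz_bounds {r : ℝ} (hr : 0 < r) {φ φ₁ φ₂ : H} (h : T.D φ φ₁) (h₁ : T.D φ₁ φ₂) :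
    ‖φ₂‖ ≤ ‖φ₂ - (r : ℂ) • φ‖ ∧ r * ‖φ‖ ≤ ‖φ₂ - (r : ℂ) • φ‖ := by
  have h6 := re_D h h₁
  have hs := reInner.symm φ φ₂
  -- The cross term `-2 r Re ⟨φ₂, φ⟩` equals `2 r ‖φ₁‖²` by parts, so it has the good sign.
  have key : ‖φ₂ - (r : ℂ) • φ‖ ^ 2 = ‖φ₂‖ ^ 2 + 2 * r * ‖φ₁‖ ^ 2 + (r * ‖φ‖) ^ 2 := by
    simp only [← reInner.self, reInner.sub_left, reInner.sub_right, reInner.smul_left,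
      reInner.smul_right, mul_pow]
    linear_combination (-2 * r) * h6 + r * hs
  have p : 0 ≤ 2 * r * ‖φ₁‖ ^ 2 := by positivity
  constructor <;> refine le_of_sq_le_sq ?_ (norm_nonneg _) <;> rw [key] <;>
    nlinarith [sq_nonneg ‖φ₂‖, sq_nonneg (r * ‖φ‖)]

/-- The estimate for the reduced operator, with the viscosity scaled out. -/
theorem norm_reduced_ge [CompleteSpace H] {r l A : ℝ} (hr : 0 < r) (hA : 1 ≤ |A|)
    {u u₁ u₂ φ φ₁ φ₂ : H} (hu : T.D u u₁) (hu₁ : T.D u₁ u₂) (hφ : T.D φ φ₁) (hφ₁ : T.D φ₁ φ₂)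
    (h : φ₂ - (r : ℂ) • φ = u) :
    √|A| / 41472 * ‖u‖
      ≤ ‖Complex.I • (A : ℂ) • (T.s u - (l : ℂ) • u + (l : ℂ) • φ) - u₂‖ := by
  have hφu : T.Q r (T.Q r u) = -φ := by
    have := T.resolvent_left hr hφ hφ₁
    rw [← neg_sub, h, map_neg, map_neg] at this
    rw [← this, neg_neg]
  have hg : T.inviscid l r u = T.s u - (l : ℂ) • u + (l : ℂ) • φ := by
    rw [inviscid_apply, hφu, smul_neg, sub_neg_eq_add]
  have ha : 1 ≤ √√|A| := Real.one_le_sqrt.2 (Real.one_le_sqrt.2 hA)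
  have ha2 : √√|A| ^ 2 = √|A| := Real.sq_sqrt (Real.sqrt_nonneg _)
  have ha4 : |A| = √√|A| ^ 4 := by
    rw [show (4 : ℕ) = 2 * 2 from rfl, pow_mul, ha2, Real.sq_sqrt (abs_nonneg _)]
  have := T.norm_le_of_solvesResolvent (l := l) ha hr ha4
    (u := u) (f := Complex.I • (A : ℂ) • (T.s u - (l : ℂ) • u + (l : ℂ) • φ) - u₂)
    ⟨u₁, u₂, hu, hu₁, by rw [hg]; simp⟩
  rwa [ha2] at this

/-- The estimate for the full operator, with the viscosity scaled out. -/
theorem norm_full_ge [CompleteSpace H] {b l A : ℝ} (hb : 1 < b) (hA : 82944 ^ 2 ≤ |A|)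
    {w w₁ w₂ φ φ₁ φ₂ : H} (hw : T.D w w₁) (hw₁ : T.D w₁ w₂) (hφ : T.D φ φ₁) (hφ₁ : T.D φ₁ φ₂)
    (h : φ₂ - (b : ℂ) • φ = w) :
    √|A| / 82944 * (1 - 1 / b) * ‖w‖
      ≤ ‖Complex.I • (A : ℂ) • (T.s w - (l : ℂ) • w + T.s φ) - w₂‖ := by
  have hr : 0 < b - 1 := by linarith
  have hb0 : 0 < b := by linarith
  have hu : φ₂ - ((b - 1 : ℝ) : ℂ) • φ = w + φ := by
    rw [← h]
    push_cast
    rw [sub_smul, one_smul]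
    abel
  have h1 := norm_reduced_ge (l := l) hr (by norm_num at hA ⊢; linarith : 1 ≤ |A|)
    (T.D_add hw hφ) (T.D_add hw₁ hφ₁) hφ hφ₁ hu
  obtain ⟨h2, -⟩ := norm_helmholtz_bounds hr hφ hφ₁
  obtain ⟨-, h3⟩ := norm_helmholtz_bounds hb0 hφ hφ₁
  rw [hu] at h2
  rw [h] at h3
  have h4 : (1 - 1 / b) * ‖w‖ ≤ ‖w + φ‖ := by
    have h5 : ‖φ‖ ≤ 1 / b * ‖w‖ := by
      rw [one_div, ← div_eq_inv_mul, le_div_iff₀ hb0, mul_comm]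
      exact h3
    have h6 := norm_sub_le (w + φ) φ
    rw [add_sub_cancel_right] at h6
    linarith
  have hsq : 82944 ≤ √|A| := Real.le_sqrt_of_sq_le hA
  -- In terms of `u = w + φ` one has `s w - l w + s φ = s u - l u + l φ` and `w'' = u'' - φ''`; also
  -- `φ'' - (b - 1) φ = u`, so the reduced estimate applies with `r = b - 1`.
  have e : Complex.I • (A : ℂ) • (T.s w - (l : ℂ) • w + T.s φ) - w₂
      = (Complex.I • (A : ℂ) • (T.s (w + φ) - (l : ℂ) • (w + φ) + (l : ℂ) • φ) - (w₂ + φ₂))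
        + φ₂ := by
    have : T.s (w + φ) - (l : ℂ) • (w + φ) + (l : ℂ) • φ = T.s w - (l : ℂ) • w + T.s φ := by
      rw [map_add, smul_add]
      abel
    rw [this]
    abel
  have h7 := norm_sub_le (Complex.I • (A : ℂ) • (T.s w - (l : ℂ) • w + T.s φ) - w₂) φ₂
  rw [e, add_sub_cancel_right, ← e] at h7
  have h8 : √|A| / 82944 * (1 - 1 / b) * ‖w‖ ≤ √|A| / 82944 * ‖w + φ‖ := by
    rw [mul_assoc]
    exact mul_le_mul_of_nonneg_left h4 (by positivity)
  -- The threshold `82944 ^ 2` is what lets half of the reduced bound absorb `‖φ₂‖ ≤ ‖w + φ‖`.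
  have h9 : ‖w + φ‖ ≤ √|A| / 82944 * ‖w + φ‖ :=
    le_mul_of_one_le_left (norm_nonneg _) ((one_le_div (by norm_num)).2 hsq)
  linarith

end TrigCalculus

/-! ### Transfer to the circle and conclusion. -/

theorem SolvesHelmholtzT.seq {b : ℝ} {φ f : ℝ → ℂ} (hf : MemL2T f) (h : SolvesHelmholtzT b φ f) :
    ∃ (hφ : MemL2T φ) (φ₁ φ₂ : EllTwo), EllTwo.calculus.D hφ.seq φ₁ ∧ EllTwo.calculus.D φ₁ φ₂ ∧
      φ₂ - (b : ℂ) • hφ.seq = hf.seq := by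
  obtain ⟨φ₂, ⟨hφ, hφ₂, φ₁, hφ₁, hd, hd₁⟩, hae⟩ := h
  refine ⟨hφ, hφ₁.seq, hφ₂.seq, hd.seq hφ hφ₁, hd₁.seq hφ₁ hφ₂, ?_⟩
  rw [← MemL2T.seq_const_mul, ← MemL2T.seq_sub]
  exact MemL2T.seq_congr _ _ hae

theorem seq_scaling {ν α : ℝ} (hν : ν ≠ 0) (x y : EllTwo) :
    (Complex.I * ((α / ν : ℝ) : ℂ)) • x - (ν : ℂ) • y
      = (ν : ℂ) • (Complex.I • ((α / ν ^ 2 : ℝ) : ℂ) • x - y) := by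
  have : (ν : ℂ) ≠ 0 := by exact_mod_cast hν
  rw [smul_sub, smul_smul, smul_smul]
  congr 2
  push_cast
  field_simp

theorem l2NormT_reducedOperator {ν : ℝ} (hν : 0 < ν) (α lam : ℝ) {u u₂ φ : ℝ → ℂ} (hu : MemL2T u)
    (hu₂ : MemL2T u₂) (hφ : MemL2T φ) : l2NormT (reducedOperator ν α lam u u₂ φ)
      = √(2 * Real.pi) * (ν * ‖Complex.I • ((α / ν ^ 2 : ℝ) : ℂ) • (EllTwo.calculus.s hu.seq
          - (lam : ℂ) • hu.seq + (lam : ℂ) • hφ.seq) - hu₂.seq‖) := by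
  have e : reducedOperator ν α lam u u₂ φ = fun y => (Complex.I * ((α / ν : ℝ) : ℂ))
      * (((Real.sin y : ℝ) : ℂ) * u y - (lam : ℂ) * u y + (lam : ℂ) * φ y) - (ν : ℂ) * u₂ y := by
    funext y
    unfold reducedOperator
    push_cast
    ring
  have h₁ := hu.sin_mul.sub (hu.const_mul lam)
  have h₂ := h₁.add (hφ.const_mul lam)
  have h₃ := h₂.const_mul (Complex.I * ((α / ν : ℝ) : ℂ))
  have h₄ := hu₂.const_mul ν
  rw [e, (h₃.sub h₄).l2NormT_eq, MemL2T.seq_sub h₃ h₄, MemL2T.seq_const_mul _ h₂,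
    MemL2T.seq_const_mul _ hu₂, MemL2T.seq_add h₁ (hφ.const_mul lam),
    MemL2T.seq_sub hu.sin_mul (hu.const_mul _), MemL2T.seq_const_mul _ hu, MemL2T.seq_const_mul _ hφ,
    MemL2T.seq_sin_mul hu, seq_scaling hν.ne', norm_smul, Complex.norm_real,
    Real.norm_of_nonneg hν.le]

theorem l2NormT_fullOperator {ν : ℝ} (hν : 0 < ν) (α lam : ℝ) {w w₂ φ : ℝ → ℂ} (hw : MemL2T w)
    (hw₂ : MemL2T w₂) (hφ : MemL2T φ) : l2NormT (fullOperator ν α lam w w₂ φ)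
      = √(2 * Real.pi) * (ν * ‖Complex.I • ((α / ν ^ 2 : ℝ) : ℂ) • (EllTwo.calculus.s hw.seq
          - (lam : ℂ) • hw.seq + EllTwo.calculus.s hφ.seq) - hw₂.seq‖) := by
  have e : fullOperator ν α lam w w₂ φ = fun y => (Complex.I * ((α / ν : ℝ) : ℂ))
      * (((Real.sin y : ℝ) : ℂ) * w y - (lam : ℂ) * w y + ((Real.sin y : ℝ) : ℂ) * φ y)
        - (ν : ℂ) * w₂ y := by
    funext y
    unfold fullOperator
    push_cast
    ring
  have h₁ := hw.sin_mul.sub (hw.const_mul lam)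
  have h₂ := h₁.add hφ.sin_mul
  have h₃ := h₂.const_mul (Complex.I * ((α / ν : ℝ) : ℂ))
  have h₄ := hw₂.const_mul ν
  rw [e, (h₃.sub h₄).l2NormT_eq, MemL2T.seq_sub h₃ h₄, MemL2T.seq_const_mul _ h₂,
    MemL2T.seq_const_mul _ hw₂, MemL2T.seq_add h₁ hφ.sin_mul,
    MemL2T.seq_sub hw.sin_mul (hw.const_mul _), MemL2T.seq_const_mul _ hw, MemL2T.seq_sin_mul hφ,
    MemL2T.seq_sin_mul hw, seq_scaling hν.ne', norm_smul, Complex.norm_real,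
    Real.norm_of_nonneg hν.le]

theorem proposition3p4 :
    ∃ K : ℝ, 0 < K ∧ ∃ C : ℝ, 0 < C ∧
      ∀ ν α lam β : ℝ, 0 < ν → ν ≤ 1 → K * ν ^ 2 ≤ |α| → 1 < |β| →
        (∀ βt : ℝ, βt ^ 2 = β ^ 2 - 1 →
          ∀ u u₂ φ : ℝ → ℂ, MemH2TWith u u₂ → SolvesHelmholtzT (βt ^ 2) φ u →
            C * Real.sqrt |α| * l2NormT u ≤ l2NormT (reducedOperator ν α lam u u₂ φ)) ∧
        (∀ w w₂ φ : ℝ → ℂ, MemH2TWith w w₂ → SolvesHelmholtzT (β ^ 2) φ w →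
            C * Real.sqrt |α| * (1 - 1 / β ^ 2) * l2NormT w
              ≤ l2NormT (fullOperator ν α lam w w₂ φ)) := by
  -- Both constants come from the full operator, `82944` being `2 * 41472`; the reduced estimate has
  -- a factor of two to spare.
  refine ⟨82944 ^ 2, by norm_num, 1 / 82944, by norm_num, fun ν α lam β hν _ hα hβ => ?_⟩
  have hβ2 : 1 < β ^ 2 := by rwa [one_lt_sq_iff_one_lt_abs]
  have hA : 82944 ^ 2 ≤ |α / ν ^ 2| := by
    rwa [abs_div, abs_of_pos (by positivity : 0 < ν ^ 2), le_div_iff₀ (by positivity)]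
  have hsqrt : ν * √|α / ν ^ 2| = √|α| := by
    rw [abs_div, abs_of_pos (by positivity : 0 < ν ^ 2), Real.sqrt_div (abs_nonneg _),
      Real.sqrt_sq hν.le, mul_div_cancel₀ _ hν.ne']
  constructor
  · intro βt hβt u u₂ φ ⟨hu, hu₂, u₁, hu₁, hd, hd₁⟩ hφu
    obtain ⟨hφ, φ₁, φ₂, hφd, hφd₁, hsolve⟩ := hφu.seq hu
    have key := TrigCalculus.norm_reduced_ge (l := lam) (by rw [hβt]; linarith)
      (by linarith : 1 ≤ |α / ν ^ 2|) (hd.seq hu hu₁) (hd₁.seq hu₁ hu₂) hφd hφd₁ hsolve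
    rw [hu.l2NormT_eq, l2NormT_reducedOperator hν α lam hu hu₂ hφ, ← hsqrt]
    calc 1 / 82944 * (ν * √|α / ν ^ 2|) * (√(2 * Real.pi) * ‖hu.seq‖)
        = √(2 * Real.pi) * (ν * (1 / 2 * (√|α / ν ^ 2| / 41472 * ‖hu.seq‖))) := by ring
      _ ≤ √(2 * Real.pi) * (ν * (√|α / ν ^ 2| / 41472 * ‖hu.seq‖)) := by
        refine mul_le_mul_of_nonneg_left (mul_le_mul_of_nonneg_left ?_ hν.le) (Real.sqrt_nonneg _)
        exact mul_le_of_le_one_left (by positivity) (by norm_num)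
      _ ≤ _ := by gcongr
  · intro w w₂ φ ⟨hw, hw₂, w₁, hw₁, hd, hd₁⟩ hφw
    obtain ⟨hφ, φ₁, φ₂, hφd, hφd₁, hsolve⟩ := hφw.seq hw
    have key := TrigCalculus.norm_full_ge (l := lam) hβ2 hA (hd.seq hw hw₁) (hd₁.seq hw₁ hw₂)
      hφd hφd₁ hsolve
    rw [hw.l2NormT_eq, l2NormT_fullOperator hν α lam hw hw₂ hφ, ← hsqrt]
    calc 1 / 82944 * (ν * √|α / ν ^ 2|) * (1 - 1 / β ^ 2) * (√(2 * Real.pi) * ‖hw.seq‖)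
        = √(2 * Real.pi) * (ν * (√|α / ν ^ 2| / 82944 * (1 - 1 / β ^ 2) * ‖hw.seq‖)) := by ring
      _ ≤ _ := by gcongr
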